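/- Let $\mathbb K$ be a field of characteristic $0$. A *simplicial complex* on a finite set $V$ is a set $C$ of non-empty subsets of $V$ (its faces) such that every non-empty subset of a face is a face. Let $\mathrm{SC}[V]$ be the $\mathbb K$-vector space with the simplicial complexes on $V$ as basis. For $V=V_1\sqcup V_2$ put $\mu_{V_1,V_2}(C_1\otimes C_2)=C_1\sqcup C_2$ and $\Delta_{V_1,V_2}(C)=C|_{V_1}\otimes C/_{V_1}$, where $C|_{V_1}=\{e\in C: e\subseteq V_1\}$ and $C/_{V_1}=\{e\cap V_2: e\in C,\ e\not\subseteq V_1\}$; $\mu_{V_1,\dots,V_n}$ and $\Delta_{V_1,\dots,V_n}$ denote the iterated maps. A *character* $\zeta$ of $\mathrm{SC}$ is a family of linear maps $\zeta_V:\mathrm{SC}[V]\to\mathbb K$, for all finite sets $V$, compatible with the product and sending the unit to $1$. It is a *characteristic function* if it takes only the values $0$ and $1$ on simplicial complexes, and it is *odd* if $\zeta(C)=0$ for every $C$ having a connected component with an even number of vertices (a vertex of $V$ lying in no face forms a component). For $n\ge 0$ set $$\chi^\zeta_V(C)(n)=\sum_{V=V_1\sqcup\dots\sqcup V_n}\zeta_V\circ\mu_{V_1,\dots,V_n}\circ\Delta_{V_1,\dots,V_n}(C),$$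 the sum being over all sequences of $n$ pairwise disjoint, possibly empty, sets with union $V$. Let $h$ be a set of non-empty subsets (edges) of $V$. An *acyclic orientation* of $h$ is a map $f$ assigning to every $e\in h$ a non-empty subset $f(e)\subseteq e$ such that, with $f_s(e)=e\setminus f(e)$, there is no sequence of distinct edges $e_1,\dots,e_k$ ($k\ge1$) with $f(e_k)\cap f_s(e_1)\ne\emptyset$ and, for each $1\le i<k$, $f(e_i)\cap f_s(e_{i+1})\neq\emptyset$ or $\emptyset\subsetneq f(e_i)\cap e_{i+1}\subsetneq f(e_{i+1})$. Let $\mathcal A_h$ be the set of acyclic orientations, and $f(h)=\{f(e):e\in h\}$. A coloring $c:V\to[n]$ is *compatible* (resp. *strictly compatible*) with $f$ if for every $e\in h$ the set $f(e)$ is contained in (resp. equal to) the set of vertices of $e$ of maximal color in $e$; let $\mathcal C_{h,f,n}$ (resp. $\mathcal C^{\circ}_{h,f,n}$) be the set of those colorings. Let $\mathrm{cc}(h)$ be the number of connected components of $h$, each vertex of $V$ in no edge counting as a component. **Proposition.** Let $\zeta$ be a character of $\mathrm{SC}$, $V$ a finite set, $C$ a simplicial complex on $V$ and $g$ its 1-skeleton,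 i.e. the set of faces of $C$ of cardinality $2$. Restriction to $g$ is a bijection $\mathcal A_C\to\mathcal A_g$; for $f\in\mathcal A_g$ denote again by $f$ its preimage in $\mathcal A_C$, so that $f(C)$ is defined (it is a simplicial complex on $V$). Then, for every integer $n\ge 0$, $$\chi^\zeta_V(C)(n)=\sum_{f\in\mathcal A_g}\zeta(f(C))\,|\mathcal C^{\circ}_{g,f,n}|.$$ Moreover $\chi^\zeta_V(C)$ is a polynomial in $n$ with coefficients in $\mathbb K$, and its value at $-n$, for every integer $n\geq 0$, is $$\chi^\zeta_V(C)(-n)=\sum_{f\in\mathcal A_g}(-1)^{\mathrm{cc}(f(g))}\,\zeta(f(C))\,|\mathcal C_{g,f,n}|.$$ If $\zeta$ is a characteristic function, then $\chi^\zeta_V(C)(n)$ is the number of pairs $(f,c)$ where $f\in\mathcal A_C$ satisfies $\zeta(f(C))\ne0$ and $c:V\to[n]$ is strictly compatible with $f$. If $\zeta$ is moreover odd, then $(-1)^{|V|}\chi^\zeta_V(C)(-n)$ is the number of pairs $(f,c)$ where $f\in\mathcal A_C$ satisfies $\zeta(f(C))\neq0$ and $c:V\to[n]$ is compatible with $f$;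 in particular $(-1)^{|V|}\chi^\zeta_V(C)(-1)$ is the number of $f\in\mathcal A_C$ with $\zeta(f(C))\ne0$. -/

import Mathlib

open scoped TensorProduct

namespace HopfSC

variable {α : Type*}

/-- Simple hypergraphs over the finite set `V`: sets of non-empty subsets of `V`. -/
@[ext]
structure SimpleHypergraph (V : Finset α) where
  edges : Set (Finset α)
  nonempty_of_mem : ∀ e ∈ edges, e.Nonempty
  subset_of_mem : ∀ e ∈ edges, e ⊆ V

/-- Simplicial complexes on the finite set `V`: families of non-empty subsets of `V` that are
closed under passing to non-empty subsets. Singletons are not required to be faces. -/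
@[ext]
structure SComplex (V : Finset α) extends PreAbstractSimplicialComplex α where
  subset_of_mem : ∀ e ∈ faces, e ⊆ V

namespace SComplex

/-- A simplicial complex, seen as a simple hypergraph whose edges are the faces. -/
def toHypergraph {V : Finset α} (C : SComplex V) : SimpleHypergraph V where
  edges := C.faces
  nonempty_of_mem := fun _ he => (C.isRelLowerSet_faces he).1
  subset_of_mem := C.subset_of_mem

/-- The 1-skeleton: the simple graph whose edges are the faces of cardinality 2. -/
def skeleton {V : Finset α} (C : SComplex V) : SimpleHypergraph V where
  edges := {e | e ∈ C.faces ∧ e.card = 2}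
  nonempty_of_mem := fun _ he => (C.isRelLowerSet_faces he.1).1
  subset_of_mem := fun e he => C.subset_of_mem e he.1

/-- The complex without faces, the only simplicial complex on the empty set. -/
def empty (V : Finset α) : SComplex V where
  faces := ∅
  isRelLowerSet_faces := isRelLowerSet_empty
  subset_of_mem := fun _ he => he.elim

end SComplex

/-! ### The Hopf monoid of simplicial complexes -/

section HopfMonoid

variable [DecidableEq α]

/-- `V` is the disjoint union of `V₁` and `V₂`. -/
structure IsSplit (V₁ V₂ V : Finset α) : Prop where
  disjoint : Disjoint V₁ V₂
  union_eq : V₁ ∪ V₂ = V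

/-- `D` is a decomposition of `V` of length `n`: a sequence of `n` pairwise disjoint, possibly
empty, subsets with union `V`. -/
structure IsDecomposition {n : ℕ} (V : Finset α) (D : Fin n → Finset α) : Prop where
  disjoint : Pairwise fun i j => Disjoint (D i) (D j)
  union_eq : Finset.univ.biUnion D = V

/-- The disjoint union of two simplicial complexes on disjoint sets. -/
def SComplex.disjUnion {V₁ V₂ V : Finset α} (h : IsSplit V₁ V₂ V)
    (C₁ : SComplex V₁) (C₂ : SComplex V₂) : SComplex V where
  faces := C₁.faces ∪ C₂.faces
  isRelLowerSet_faces := C₁.isRelLowerSet_faces.union C₂.isRelLowerSet_faces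
  subset_of_mem := by
    rintro e (he | he)
    · exact (C₁.subset_of_mem e he).trans (h.union_eq ▸ Finset.subset_union_left)
    · exact (C₂.subset_of_mem e he).trans (h.union_eq ▸ Finset.subset_union_right)

/-- The restriction `C|_{W} = {e ∈ C | e ⊆ W}`. -/
def SComplex.restrict {V : Finset α} (C : SComplex V) (W : Finset α) : SComplex W where
  faces := {e | e ∈ C.faces ∧ e ⊆ W}
  isRelLowerSet_faces := fun _ he =>
    ⟨(C.isRelLowerSet_faces he.1).1, fun _ hba hb =>
      ⟨(C.isRelLowerSet_faces he.1).2 hba hb, Finset.Subset.trans hba he.2⟩⟩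
  subset_of_mem := fun _ he => he.2

/-- The contraction `C/_{V₁} = {e ∩ V₂ | e ∈ C, e ⊈ V₁}`, where `V₂` is the complement of `V₁`. -/
def SComplex.contract {V₁ V₂ V : Finset α} (h : IsSplit V₁ V₂ V) (C : SComplex V) :
    SComplex V₂ where
  faces := {e' | ∃ e ∈ C.faces, ¬ e ⊆ V₁ ∧ e' = e ∩ V₂}
  isRelLowerSet_faces := by
    rintro _ ⟨e, he, hne, rfl⟩
    refine ⟨?_, fun b hb hbn => ?_⟩
    · obtain ⟨v, hve, hv⟩ := Finset.not_subset.1 hne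
      have hvV := C.subset_of_mem e he hve
      rw [← h.union_eq, Finset.mem_union] at hvV
      exact ⟨v, Finset.mem_inter.2 ⟨hve, hvV.resolve_left hv⟩⟩
    · have hb1 : b ⊆ e := Finset.Subset.trans hb Finset.inter_subset_left
      have hb2 : b ⊆ V₂ := Finset.Subset.trans hb Finset.inter_subset_right
      refine ⟨b, (C.isRelLowerSet_faces he).2 hb1 hbn, fun hb3 => ?_,
        (Finset.inter_eq_left.2 hb2).symm⟩
      obtain ⟨v, hv⟩ := hbn
      exact Finset.disjoint_left.1 h.disjoint (hb3 hv) (hb2 hv)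
  subset_of_mem := by
    rintro _ ⟨e, _, _, rfl⟩
    exact Finset.inter_subset_right

/-- The vector space `SC[V]`, with the simplicial complexes on `V` as a basis. -/
abbrev SC (K : Type*) [Field K] (V : Finset α) : Type _ := SComplex V →₀ K

/-- A simplicial complex as an element of `SC[V]`. -/
noncomputable abbrev basisElem (K : Type*) [Field K] {V : Finset α} (C : SComplex V) : SC K V :=
  Finsupp.single C 1

variable (K : Type*) [Field K]

/-- The product `μ_{V₁,V₂} : SC[V₁] ⊗ SC[V₂] → SC[V]`, `C₁ ⊗ C₂ ↦ C₁ ⊔ C₂`. -/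
noncomputable def product {V₁ V₂ V : Finset α} (h : IsSplit V₁ V₂ V) :
    SC K V₁ ⊗[K] SC K V₂ →ₗ[K] SC K V :=
  TensorProduct.lift <|
    Finsupp.linearCombination K fun C₁ : SComplex V₁ =>
      Finsupp.linearCombination K fun C₂ : SComplex V₂ => basisElem K (C₁.disjUnion h C₂)

/-- The co-product `Δ_{V₁,V₂} : SC[V] → SC[V₁] ⊗ SC[V₂]`, `C ↦ C|_{V₁} ⊗ C/_{V₁}`. -/
noncomputable def coproduct {V₁ V₂ V : Finset α} (h : IsSplit V₁ V₂ V) :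
    SC K V →ₗ[K] SC K V₁ ⊗[K] SC K V₂ :=
  Finsupp.linearCombination K fun C : SComplex V =>
    basisElem K (C.restrict V₁) ⊗ₜ[K] basisElem K (C.contract h)

/-- Dropping the last part of a decomposition. -/
theorem IsDecomposition.init {n : ℕ} {V : Finset α} {D : Fin (n + 1) → Finset α}
    (h : IsDecomposition V D) :
    IsDecomposition (Finset.univ.biUnion (Fin.init D)) (Fin.init D) :=
  ⟨fun _ _ hij => h.disjoint fun hc => hij (Fin.castSucc_injective n hc), rfl⟩

/-- A decomposition `(V₁, …, Vₙ₊₁)` splits `V` into `V₁ ⊔ … ⊔ Vₙ` and `Vₙ₊₁`. -/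
theorem IsDecomposition.isSplit {n : ℕ} {V : Finset α} {D : Fin (n + 1) → Finset α}
    (h : IsDecomposition V D) :
    IsSplit (Finset.univ.biUnion (Fin.init D)) (D (Fin.last n)) V := by
  refine ⟨?_, ?_⟩
  · rw [Finset.disjoint_biUnion_left]
    intro i _
    exact h.disjoint (Fin.castSucc_lt_last i).ne
  · rw [← h.union_eq]
    ext v
    simp only [Finset.mem_union, Finset.mem_biUnion, Finset.mem_univ, true_and, Fin.init]
    constructor
    · rintro (⟨i, hi⟩ | hl)
      · exact ⟨_, hi⟩
      · exact ⟨_, hl⟩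
    · rintro ⟨i, hi⟩
      induction i using Fin.lastCases with
      | last => exact Or.inr hi
      | cast i => exact Or.inl ⟨i, hi⟩

/-- The composite `μ_{V₁,…,Vₙ} ∘ Δ_{V₁,…,Vₙ} : SC[V] → SC[V]` of the iterated co-product and the
iterated product along a decomposition, where both are iterated by splitting off the last part:
with `W = V₁ ⊔ … ⊔ Vₙ`,
`μ_{V₁,…,Vₙ₊₁} ∘ Δ_{V₁,…,Vₙ₊₁} = μ_{W,Vₙ₊₁} ∘ ((μ_{V₁,…,Vₙ} ∘ Δ_{V₁,…,Vₙ}) ⊗ id) ∘ Δ_{W,Vₙ₊₁}`.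
For `n = 0` (so `V = ∅`) both maps are the identity of `SC[∅] = K`. -/
noncomputable def productCoproduct : (n : ℕ) → (V : Finset α) → (D : Fin n → Finset α) →
    IsDecomposition V D → (SC K V →ₗ[K] SC K V)
  | 0, _, _, _ => LinearMap.id
  | n + 1, _, D, h =>
    product K h.isSplit ∘ₗ
      TensorProduct.map (productCoproduct n _ (Fin.init D) h.init) LinearMap.id ∘ₗ
        coproduct K h.isSplit

variable (α)

/-- Characters of the Hopf monoid `SC`: families of linear maps `SC[V] → K`, for all finite sets
`V`, that are compatible with the product and send the unit to `1`. -/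
structure Character where
  toFun : ∀ V : Finset α, SC K V →ₗ[K] K
  map_unit : toFun ∅ (basisElem K (SComplex.empty ∅)) = 1
  map_product : ∀ {V₁ V₂ V : Finset α} (h : IsSplit V₁ V₂ V) (x : SC K V₁) (y : SC K V₂),
    toFun V (product K h (x ⊗ₜ[K] y)) = toFun V₁ x * toFun V₂ y

variable {α}

instance (V : Finset α) (n : ℕ) : Finite {D : Fin n → Finset α // IsDecomposition V D} := by
  refine Finite.of_injective
    (β := Fin n → {s : Finset α // s ∈ V.powerset})
    (fun D i => ⟨D.1 i, Finset.mem_powerset.2 <|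
      (Finset.subset_biUnion_of_mem D.1 (Finset.mem_univ i)).trans D.2.union_eq.subset⟩) ?_
  · intro D D' h
    apply Subtype.ext
    funext i
    exact congrArg Subtype.val (congrFun h i)

noncomputable instance (V : Finset α) (n : ℕ) :
    Fintype {D : Fin n → Finset α // IsDecomposition V D} :=
  Fintype.ofFinite _

variable {K}

/-- The invariant
`χ^ζ_V(x)(n) = ∑_{V = V₁ ⊔ … ⊔ Vₙ} ζ_V (μ_{V₁,…,Vₙ} (Δ_{V₁,…,Vₙ} (x)))`,
the sum running over the decompositions of `V` of length `n`. -/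
noncomputable def chi (ζ : Character α K) (V : Finset α) (x : SC K V) (n : ℕ) : K :=
  ∑ D : {D : Fin n → Finset α // IsDecomposition V D},
    ζ.toFun V (productCoproduct K n V D.1 D.2 x)

end HopfMonoid

/-! ### Orientations and colorings -/

section Orientations

variable [DecidableEq α] {V : Finset α}

/-- Acyclic orientations of a simple hypergraph: maps `f` sending each edge `e` to a non-empty
subset `f e` of `e`, such that there is no directed cycle, i.e. no sequence of distinct edges
`e₀, …, eₖ` for which, writing `f_s(e) = e \ f(e)`,
* for all `i < k`, `f(eᵢ) ∩ f_s(eᵢ₊₁) ≠ ∅` or `∅ ⊊ f(eᵢ) ∩ eᵢ₊₁ ⊊ f(eᵢ₊₁)`;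
* `f(eₖ) ∩ f_s(e₀) ≠ ∅`. -/
structure AcyclicOrientation (h : SimpleHypergraph V) where
  toFun : h.edges → Finset α
  nonempty : ∀ e, (toFun e).Nonempty
  subset : ∀ e, toFun e ⊆ e.1
  acyclic : ¬ ∃ (k : ℕ) (e : Fin (k + 1) → h.edges), Function.Injective e ∧
    (∀ i : Fin k,
      (toFun (e i.castSucc) ∩ ((e i.succ).1 \ toFun (e i.succ))).Nonempty ∨
      ((toFun (e i.castSucc) ∩ (e i.succ).1).Nonempty ∧
        toFun (e i.castSucc) ∩ (e i.succ).1 ⊂ toFun (e i.succ))) ∧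
    (toFun (e (Fin.last k)) ∩ ((e 0).1 \ toFun (e 0))).Nonempty

instance (h : SimpleHypergraph V) : Finite (AcyclicOrientation h) := by
  have : Finite h.edges :=
    (V.powerset.finite_toSet.subset fun e he => by
      simpa using h.subset_of_mem e he).to_subtype
  refine Finite.of_injective
    (β := h.edges → {s : Finset α // s ∈ V.powerset})
    (fun f e => ⟨f.toFun e, Finset.mem_powerset.2
      ((f.subset e).trans (h.subset_of_mem e.1 e.2))⟩) ?_
  intro f f' hff
  cases f
  cases f'
  congr
  funext e
  exact congrArg Subtype.val (congrFun hff e)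

noncomputable instance (h : SimpleHypergraph V) : Fintype (AcyclicOrientation h) :=
  Fintype.ofFinite _

/-- The image `f(h) = {f(e) | e ∈ h}`. -/
def AcyclicOrientation.image {h : SimpleHypergraph V} (f : AcyclicOrientation h) :
    SimpleHypergraph V where
  edges := Set.range f.toFun
  nonempty_of_mem := by
    rintro _ ⟨e, rfl⟩
    exact f.nonempty e
  subset_of_mem := by
    rintro _ ⟨e, rfl⟩
    exact (f.subset e).trans (h.subset_of_mem e.1 e.2)

/-- The image `f(C) = {f(e) | e ∈ C}` of a simplicial complex by an acyclic orientation, which is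
again a simplicial complex. -/
def AcyclicOrientation.imageComplex {C : SComplex V} (f : AcyclicOrientation C.toHypergraph) :
    SComplex V where
  faces := Set.range f.toFun
  isRelLowerSet_faces := by
    rintro _ ⟨e, rfl⟩
    refine ⟨f.nonempty e, fun J hJ hJn => ?_⟩
    have hJ' : J ⊆ f.toFun e := hJ
    have hJC : J ∈ C.toHypergraph.edges :=
      (C.isRelLowerSet_faces e.2).2 (hJ'.trans (f.subset e)) hJn
    refine ⟨⟨J, hJC⟩, ?_⟩
    by_contra hne
    have hsub : f.toFun ⟨J, hJC⟩ ⊆ J := f.subset ⟨J, hJC⟩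
    obtain ⟨v, hvJ, hv⟩ : ∃ v ∈ J, v ∉ f.toFun ⟨J, hJC⟩ := by
      by_contra hcon
      push Not at hcon
      exact hne (Finset.Subset.antisymm hsub hcon)
    have hJe : (⟨J, hJC⟩ : C.toHypergraph.edges) ≠ e := by
      rintro rfl
      exact hv (hJ' hvJ)
    apply f.acyclic
    refine ⟨1, ![⟨J, hJC⟩, e], ?_, ?_, ?_⟩
    · intro i j hij
      fin_cases i <;> fin_cases j <;> simp_all
    · intro i
      fin_cases i
      right
      have hJe' : f.toFun ⟨J, hJC⟩ ∩ e.1 = f.toFun ⟨J, hJC⟩ :=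
        Finset.inter_eq_left.2 ((hsub.trans hJ').trans (f.subset e))
      change (f.toFun ⟨J, hJC⟩ ∩ e.1).Nonempty ∧ f.toFun ⟨J, hJC⟩ ∩ e.1 ⊂ f.toFun e
      rw [hJe']
      exact ⟨f.nonempty _, Finset.ssubset_iff_of_subset (hsub.trans hJ') |>.2 ⟨v, hJ' hvJ, hv⟩⟩
    · exact ⟨v, Finset.mem_inter.2 ⟨hJ' hvJ, Finset.mem_sdiff.2 ⟨hvJ, hv⟩⟩⟩
  subset_of_mem := by
    rintro _ ⟨e, rfl⟩
    exact (f.subset e).trans (C.subset_of_mem e.1 e.2)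

/-- The vertex `v` of the edge `e` has maximal color in `e`. -/
def IsMaximalIn {n : ℕ} (c : V → Fin n) (e : Finset α) (v : V) : Prop :=
  v.1 ∈ e ∧ ∀ w : V, w.1 ∈ e → c w ≤ c v

/-- A coloring is compatible with `f` if, for each edge `e`, the elements of `f(e)` are maximal
in `e`. -/
def Compatible {h : SimpleHypergraph V} (f : AcyclicOrientation h) {n : ℕ} (c : V → Fin n) :
    Prop :=
  ∀ (e : h.edges) (v : V), v.1 ∈ f.toFun e → IsMaximalIn c e.1 v

/-- A coloring is strictly compatible with `f` if, for each edge `e`, `f(e)` is exactly the set of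
maximal elements of `e`. -/
def StrictlyCompatible {h : SimpleHypergraph V} (f : AcyclicOrientation h) {n : ℕ}
    (c : V → Fin n) : Prop :=
  ∀ (e : h.edges) (v : V), v.1 ∈ f.toFun e ↔ IsMaximalIn c e.1 v

end Orientations

/-! ### Connected components, special characters -/

/-- The graph on the vertex set `V` joining distinct vertices that share an edge of `h`. -/
def SimpleHypergraph.toGraph {V : Finset α} (h : SimpleHypergraph V) : SimpleGraph V :=
  SimpleGraph.fromRel fun v w => ∃ e ∈ h.edges, v.1 ∈ e ∧ w.1 ∈ e

/-- The number of connected components of `h`; a vertex in no edge forms a component. -/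
noncomputable def SimpleHypergraph.cc {V : Finset α} (h : SimpleHypergraph V) : ℕ :=
  Nat.card h.toGraph.ConnectedComponent

variable [DecidableEq α] {K : Type*} [Field K]

/-- The value `ζ_V(C)` of a character on a simplicial complex. -/
noncomputable def Character.val (ζ : Character α K) {V : Finset α} (C : SComplex V) : K :=
  ζ.toFun V (basisElem K C)

/-- Characteristic functions: characters with values in `{0, 1}` on simplicial complexes. -/
def Character.IsCharacteristic (ζ : Character α K) : Prop :=
  ∀ (V : Finset α) (C : SComplex V), ζ.val C = 0 ∨ ζ.val C = 1

/-- Odd characters: those that vanish on every simplicial complex with a connected component with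
an even number of vertices. -/
def Character.IsOdd (ζ : Character α K) : Prop :=
  ∀ (V : Finset α) (C : SComplex V),
    (∃ c : C.toHypergraph.toGraph.ConnectedComponent, Even (Nat.card c.supp)) → ζ.val C = 0

end HopfSC

open HopfSC

/-! Decompositions of V into n parts are colorings V → [n], and the iterated coproduct followed by
the product keeps exactly the monochromatic faces of C (`productCoproduct_basisElem`). These form
f(C), where f sends each face to its vertices of maximal color (`parts_colorClass`). This f is the
only orientation strictly compatible with the coloring, so grouping colorings by f gives the values
at n ≥ 0.

The passage to the 1-skeleton rests on a pairwise test: v lies in f(e) iff v lies in f({v, w}) for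
all other w in e (`mem_iff_restrictSkeleton`). Hence restriction is injective. It is surjective
because every acyclic orientation of a graph comes from a coloring (`exists_strictlyCompatible`).

For f fixed on g, compatible colorings are constant on the components of f(g), and f induces a
strict partial order on these components. Compatible and strictly compatible colorings become weakly
and strictly order-preserving maps, so reciprocity for order polynomials (`exists_orderPolynomial`)
yields a polynomial and the sign (-1)^cc(f(g)). If ζ is odd and ζ(f(C)) ≠ 0, all components are odd,
so cc has the parity of |V| and the signs cancel. -/

namespace HopfSC
-- Order polynomials of finite posets and their reciprocity.
section OrderPolynomial
open Polynomial

/-- The colorings that strictly increase along a relation. -/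
def StrictColoring {X : Type*} (r : X → X → Prop) (n : ℕ) : Type _ :=
  {c : X → Fin n // ∀ u v, r u v → c u < c v}

/-- The colorings that weakly increase along a relation. -/
def WeakColoring {X : Type*} (r : X → X → Prop) (n : ℕ) : Type _ :=
  {c : X → Fin n // ∀ u v, r u v → c u ≤ c v}

theorem card_strictMono_fin (p n : ℕ) :
    Nat.card {c : Fin p → Fin n // StrictMono c} = n.choose p := by
  have e : {c : Fin p → Fin n // StrictMono c} ≃ (Fin p ↪o Fin n) :=
    { toFun := fun c => OrderEmbedding.ofStrictMono c.1 c.2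
      invFun := fun c => ⟨c, c.strictMono⟩
      left_inv := fun _ => rfl
      right_inv := fun _ => by ext; rfl }
  rw [Nat.card_congr (e.trans Set.powersetCard.ofFinEmbEquiv), Set.powersetCard.card]
  simp

theorem add_le_of_strictMono {p m : ℕ} {c : Fin p → Fin m} (hc : StrictMono c) :
    ∀ (d : ℕ) (i j : Fin p), (j : ℕ) = i + d → (c i : ℕ) + d ≤ c j := by
  intro d
  induction d with
  | zero =>
    intro i j h
    have : i = j := Fin.ext (by omega)
    simp [this]
  | succ d ih =>
    intro i j h
    have h1 := ih i ⟨i + d, by omega⟩ rfl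
    have h2 : c ⟨i + d, by omega⟩ < c j := hc (by simp only [Fin.lt_def]; omega)
    simp only [Fin.lt_def] at h2
    omega

/-- Adding i to the i-th value turns weak growth into strict growth and raises the largest possible
value from n - 1 to n + p - 2. -/
theorem card_monotone_fin (p n : ℕ) :
    Nat.card {c : Fin p → Fin n // Monotone c} = (n + p - 1).choose p := by
  rw [← card_strictMono_fin]
  refine Nat.card_congr
    { toFun := fun c => ⟨fun i => ⟨c.1 i + i, by have := (c.1 i).2; omega⟩, fun i j hij => ?_⟩
      invFun := fun c => ⟨fun i => ⟨c.1 i - i, ?_⟩, fun i j hij => ?_⟩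
      left_inv := fun c => ?_
      right_inv := fun c => ?_ }
  · have := c.2 hij.le
    simp only [Fin.lt_def, Fin.le_def] at *
    omega
  -- Growth from i to the last index bounds the value by n + i - 1; growth from index 0 makes the
  -- truncated subtraction exact.
  · have h := add_le_of_strictMono c.2 (p - 1 - i) i ⟨p - 1, Nat.sub_lt i.pos one_pos⟩
      (show p - 1 = i + (p - 1 - i) by omega)
    have h' := (c.1 ⟨p - 1, Nat.sub_lt i.pos one_pos⟩).2
    have h2 := add_le_of_strictMono c.2 i ⟨0, i.pos⟩ i (by simp)
    omega
  · have h := add_le_of_strictMono c.2 (j - i) i j (by simp only [Fin.le_def] at hij; omega)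
    simp only [Fin.le_def] at *
    omega
  · ext i
    simp
  · ext i
    have h2 := add_le_of_strictMono c.2 i ⟨0, i.pos⟩ i (by simp)
    simp only
    omega

theorem exists_equiv_fin_of_total {X : Type*} [Fintype X] (r : X → X → Prop)
    (hirr : ∀ u, ¬ r u u) (htrans : ∀ u v w, r u v → r v w → r u w)
    (htot : ∀ u v, u ≠ v → r u v ∨ r v u) :
    ∃ e : X ≃ Fin (Fintype.card X), ∀ u v, r u v ↔ e u < e v := by
  classical
  have : IsStrictTotalOrder X r :=
    { irrefl := hirr, trans := htrans
      trichotomous := fun a b h1 h2 => by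
        by_contra h
        rcases htot a b h with h | h <;> contradiction }
  let _ := linearOrderOfSTO r
  let e := monoEquivOfFin X rfl
  exact ⟨e.symm.toEquiv, fun u v => (e.symm.lt_iff_lt (x := u) (y := v)).symm⟩

theorem eval_neg_descPochhammer {K : Type*} [Field K] (p n : ℕ) :
    (descPochhammer K p).eval (-(n : K)) =
      (-1) ^ p * (p.factorial * (n + p - 1).choose p : ℕ) := by
  have h := ascPochhammer_eval_neg_eq_descPochhammer K (-(n : K)) p
  rw [neg_neg] at h
  have h2 : (descPochhammer K p).eval (-(n : K)) = (-1) ^ p * (ascPochhammer K p).eval (n : K) := by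
    rw [h, ← mul_assoc, ← mul_pow]
    simp
  rw [h2, ascPochhammer_nat_eq_natCast_ascFactorial, Nat.ascFactorial_eq_factorial_mul_choose']

/-- Along a chain, colorings are increasing sequences, so P is the binomial polynomial;
characteristic 0 makes the factorial invertible. -/
theorem exists_orderPolynomial_of_total {K : Type*} [Field K] [CharZero K] {X : Type*} [Fintype X]
    (r : X → X → Prop)
    (hirr : ∀ u, ¬ r u u) (htrans : ∀ u v w, r u v → r v w → r u w)
    (htot : ∀ u v, u ≠ v → r u v ∨ r v u) :
    ∃ P : K[X], ∀ n : ℕ, P.eval (n : K) = (Nat.card (StrictColoring r n) : K) ∧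
      P.eval (-(n : K)) = (-1) ^ Fintype.card X * (Nat.card (WeakColoring r n) : K) := by
  obtain ⟨e, he⟩ := exists_equiv_fin_of_total r hirr htrans htot
  have hf : ((Fintype.card X).factorial : K) ≠ 0 := by exact_mod_cast Nat.factorial_ne_zero _
  refine ⟨C ((Fintype.card X).factorial : K)⁻¹ * descPochhammer K (Fintype.card X),
    fun n => ⟨?_, ?_⟩⟩
  · have h1 : Nat.card (StrictColoring r n) = n.choose (Fintype.card X) := by
      rw [← card_strictMono_fin]
      refine Nat.card_congr (Equiv.subtypeEquiv (e.arrowCongr (Equiv.refl _)) fun c => ?_)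
      simp only [StrictMono, e.forall_congr_left, he, Equiv.apply_symm_apply]
      rfl
    rw [h1, eval_mul, eval_C, descPochhammer_eval_eq_descFactorial,
      Nat.descFactorial_eq_factorial_mul_choose]
    push_cast
    field_simp
  · have h1 : Nat.card (WeakColoring r n) = (n + Fintype.card X - 1).choose (Fintype.card X) := by
      rw [← card_monotone_fin]
      refine Nat.card_congr (Equiv.subtypeEquiv (e.arrowCongr (Equiv.refl _)) fun c => ?_)
      simp only [monotone_iff_forall_lt, e.forall_congr_left, he, Equiv.apply_symm_apply]
      rfl
    rw [h1, eval_mul, eval_C, eval_neg_descPochhammer]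
    push_cast
    field_simp

/-- Adding the relation `a < b` to a transitive relation. -/
def addRel {X : Type*} (r : X → X → Prop) (a b : X) (u v : X) : Prop :=
  r u v ∨ ((u = a ∨ r u a) ∧ (v = b ∨ r b v))

/-- Identifying `b` with `a` in a transitive relation. -/
def mergeRel {X : Type*} (r : X → X → Prop) (a b : X) (u v : {x : X // x ≠ b}) : Prop :=
  r u v ∨ (r u b ∧ (v.1 = a ∨ r a v)) ∨ ((u.1 = a ∨ r u a) ∧ r b v)

/-- Colorings of the identified relation are colorings that agree on the identified points. -/
def mergeColoring {X : Type*} {n : ℕ} (a b : X) (hab : a ≠ b) [DecidableEq X] :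
    ({x : X // x ≠ b} → Fin n) ≃ {c : X → Fin n // c a = c b} where
  toFun c := ⟨fun x => if h : x = b then c ⟨a, hab⟩ else c ⟨x, h⟩, by simp [hab]⟩
  invFun c x := c.1 x
  left_inv c := by
    ext x
    simp [x.2]
  right_inv c := by
    ext x
    by_cases h : x = b
    · simp [h, c.2]
    · simp [h]

/-- Trichotomy for the colors of a and b. -/
theorem card_strictColoring_split {X : Type*} [Fintype X] (r : X → X → Prop) {a b : X}
    (hirr : ∀ u, ¬ r u u) (htrans : ∀ u v w, r u v → r v w → r u w) (hab : a ≠ b) (n : ℕ) :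
    Nat.card (StrictColoring r n) = Nat.card (StrictColoring (addRel r a b) n) +
      Nat.card (StrictColoring (addRel r b a) n) +
      Nat.card (StrictColoring (mergeRel r a b) n) := by
  classical
  have h1 : ∀ a b : X, Nat.card (StrictColoring (addRel r a b) n) =
      ({c : X → Fin n | (∀ u v, r u v → c u < c v) ∧ c a < c b} : Finset _).card := by
    intro a b
    rw [StrictColoring, Nat.card_eq_fintype_card, Fintype.card_subtype]
    congr 1
    ext c
    simp only [Finset.mem_filter, Finset.mem_univ, true_and]
    unfold addRel
    grind
  have h2 : Nat.card (StrictColoring (mergeRel r a b) n) =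
      ({c : X → Fin n | (∀ u v, r u v → c u < c v) ∧ c a = c b} : Finset _).card := by
    rw [← Fintype.card_subtype, ← Nat.card_eq_fintype_card]
    refine Nat.card_congr (((mergeColoring (n := n) a b hab).subtypeEquiv
      (q := fun c => ∀ u v, r u v → c.1 u < c.1 v) fun c => ?_).trans
      ((Equiv.subtypeSubtypeEquivSubtypeInter _
        (fun c : X → Fin n => ∀ u v, r u v → c u < c v)).trans
        (Equiv.subtypeEquivRight fun c => and_comm)))
    obtain ⟨d, rfl⟩ := (mergeColoring (n := n) a b hab).symm.surjective c
    rw [Equiv.apply_symm_apply]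
    simp only [mergeColoring, Equiv.coe_fn_symm_mk, mergeRel]
    refine ⟨fun h u v huv => ?_, fun h u v huv => ?_⟩
    · by_cases hu : u = b
      · subst hu
        by_cases hv : v = u
        · subst hv
          exact absurd huv (hirr _)
        · rw [← d.2]
          exact h ⟨a, hab⟩ ⟨v, hv⟩ (Or.inr (Or.inr ⟨Or.inl rfl, huv⟩))
      · by_cases hv : v = b
        · subst hv
          rw [← d.2]
          exact h ⟨u, hu⟩ ⟨a, hab⟩ (Or.inr (Or.inl ⟨huv, Or.inl rfl⟩))
        · exact h ⟨u, hu⟩ ⟨v, hv⟩ (Or.inl huv)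
    · have := d.2
      grind
  rw [h1, h1, h2, StrictColoring, Nat.card_eq_fintype_card, Fintype.card_subtype,
    ← Finset.card_union_of_disjoint, ← Finset.card_union_of_disjoint]
  · congr 1
    ext c
    simp only [Finset.mem_filter, Finset.mem_union, Finset.mem_univ, true_and]
    have := lt_trichotomy (c a) (c b)
    grind
  · rw [Finset.disjoint_left]
    simp only [Finset.mem_filter, Finset.mem_union, Finset.mem_univ, true_and]
    grind
  · rw [Finset.disjoint_left]
    simp only [Finset.mem_filter, Finset.mem_univ, true_and]
    grind

/-- Inclusion-exclusion: the conditions c a ≤ c b and c b ≤ c a cover everything and overlap where c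
a = c b. -/
theorem card_weakColoring_split {X : Type*} [Fintype X] (r : X → X → Prop) {a b : X}
    (htrans : ∀ u v w, r u v → r v w → r u w) (hab : a ≠ b) (n : ℕ) :
    Nat.card (WeakColoring r n) + Nat.card (WeakColoring (mergeRel r a b) n) =
      Nat.card (WeakColoring (addRel r a b) n) + Nat.card (WeakColoring (addRel r b a) n) := by
  classical
  have h1 : ∀ a b : X, Nat.card (WeakColoring (addRel r a b) n) =
      ({c : X → Fin n | (∀ u v, r u v → c u ≤ c v) ∧ c a ≤ c b} : Finset _).card := by
    intro a b
    rw [WeakColoring, Nat.card_eq_fintype_card, Fintype.card_subtype]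
    congr 1
    ext c
    simp only [Finset.mem_filter, Finset.mem_univ, true_and]
    unfold addRel
    grind
  have h2 : Nat.card (WeakColoring (mergeRel r a b) n) =
      ({c : X → Fin n | (∀ u v, r u v → c u ≤ c v) ∧ c a = c b} : Finset _).card := by
    rw [← Fintype.card_subtype, ← Nat.card_eq_fintype_card]
    refine Nat.card_congr (((mergeColoring (n := n) a b hab).subtypeEquiv
      (q := fun c => ∀ u v, r u v → c.1 u ≤ c.1 v) fun c => ?_).trans
      ((Equiv.subtypeSubtypeEquivSubtypeInter _
        (fun c : X → Fin n => ∀ u v, r u v → c u ≤ c v)).trans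
        (Equiv.subtypeEquivRight fun c => and_comm)))
    obtain ⟨d, rfl⟩ := (mergeColoring (n := n) a b hab).symm.surjective c
    rw [Equiv.apply_symm_apply]
    simp only [mergeColoring, Equiv.coe_fn_symm_mk, mergeRel]
    refine ⟨fun h u v huv => ?_, fun h u v huv => ?_⟩
    · by_cases hu : u = b
      · subst hu
        by_cases hv : v = u
        · subst hv
          exact le_rfl
        · rw [← d.2]
          exact h ⟨a, hab⟩ ⟨v, hv⟩ (Or.inr (Or.inr ⟨Or.inl rfl, huv⟩))
      · by_cases hv : v = b
        · subst hv
          rw [← d.2]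
          exact h ⟨u, hu⟩ ⟨a, hab⟩ (Or.inr (Or.inl ⟨huv, Or.inl rfl⟩))
        · exact h ⟨u, hu⟩ ⟨v, hv⟩ (Or.inl huv)
    · have := d.2
      grind
  rw [h1, h1, h2, WeakColoring, Nat.card_eq_fintype_card, Fintype.card_subtype,
    eq_comm, ← Finset.card_union_add_card_inter]
  congr 2
  · ext c
    simp only [Finset.mem_filter, Finset.mem_union, Finset.mem_univ, true_and]
    have := le_total (c a) (c b)
    grind
  · ext c
    simp only [Finset.mem_filter, Finset.mem_inter, Finset.mem_univ, true_and]
    grind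

/-- Induction on the number of unrelated ordered pairs, splitting at an incomparable pair a, b until
the order is total. Merging a and b loses one point, and the resulting change of sign matches the
minus sign in the inclusion-exclusion for weak colorings. -/
theorem exists_orderPolynomial_aux {K : Type*} [Field K] [CharZero K] (m : ℕ) :
    ∀ {X : Type*} [Fintype X] (r : X → X → Prop)
    (_ : ∀ u, ¬ r u u) (_ : ∀ u v w, r u v → r v w → r u w)
    (_ : Nat.card {p : X × X // ¬ r p.1 p.2} = m),
    ∃ P : K[X], ∀ n : ℕ, P.eval (n : K) = (Nat.card (StrictColoring r n) : K) ∧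
      P.eval (-(n : K)) = (-1) ^ Fintype.card X * (Nat.card (WeakColoring r n) : K) := by
  classical
  induction m using Nat.strong_induction_on with
  | _ m ih =>
  intro X _ r hirr htrans hm
  by_cases htot : ∀ u v, u ≠ v → r u v ∨ r v u
  · exact exists_orderPolynomial_of_total r hirr htrans htot
  push Not at htot
  obtain ⟨a, b, hab, hnab, hnba⟩ := htot
  have key : ∀ a b : X, a ≠ b → ¬ r a b → ¬ r b a →
      ∃ P : K[X], ∀ n : ℕ, P.eval (n : K) = (Nat.card (StrictColoring (addRel r a b) n) : K) ∧
      P.eval (-(n : K)) =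
        (-1) ^ Fintype.card X * (Nat.card (WeakColoring (addRel r a b) n) : K) := by
    intro a b hab hnab hnba
    refine ih _ ?_ (addRel r a b) ?_ ?_ rfl
    · rw [← hm, Nat.card_eq_fintype_card, Nat.card_eq_fintype_card]
      refine Fintype.card_lt_of_injective_not_surjective
        (f := fun p : {p : X × X // ¬ addRel r a b p.1 p.2} =>
          (⟨p.1, fun h => p.2 (Or.inl h)⟩ : {p : X × X // ¬ r p.1 p.2})) ?_ ?_
      · intro p q h
        exact Subtype.ext (congrArg (fun x => x.1) h)
      · intro h
        obtain ⟨p, hp⟩ := h ⟨(a, b), hnab⟩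
        have : p.1 = (a, b) := congrArg (fun x => x.1) hp
        refine p.2 ?_
        rw [this]
        exact Or.inr ⟨Or.inl rfl, Or.inl rfl⟩
    · unfold addRel; grind
    · unfold addRel; grind
  obtain ⟨P₁, h₁⟩ := key a b hab hnab hnba
  obtain ⟨P₂, h₂⟩ := key b a hab.symm hnba hnab
  obtain ⟨P₃, h₃⟩ : ∃ P : K[X], ∀ n : ℕ,
      P.eval (n : K) = (Nat.card (StrictColoring (mergeRel r a b) n) : K) ∧
      P.eval (-(n : K)) = (-1) ^ Fintype.card {x : X // x ≠ b} *
        (Nat.card (WeakColoring (mergeRel r a b) n) : K) := by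
    refine ih _ ?_ (mergeRel r a b) ?_ ?_ rfl
    · rw [← hm, Nat.card_eq_fintype_card, Nat.card_eq_fintype_card]
      refine Fintype.card_lt_of_injective_not_surjective
        (f := fun p : {p : {x : X // x ≠ b} × {x : X // x ≠ b} // ¬ mergeRel r a b p.1 p.2} =>
          (⟨(p.1.1.1, p.1.2.1), fun h => p.2 (Or.inl h)⟩ : {p : X × X // ¬ r p.1 p.2})) ?_ ?_
      · intro p q h
        have h' := congrArg (fun x => x.1) h
        simp only [Prod.mk.injEq] at h'
        exact Subtype.ext (Prod.ext (Subtype.ext h'.1) (Subtype.ext h'.2))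
      -- The diagonal pair (b, b) is unrelated by irreflexivity and disappears with b, so the count
      -- drops.
      · intro h
        obtain ⟨p, hp⟩ := h ⟨(b, b), hirr b⟩
        have : p.1.1.1 = b := congrArg (fun x => x.1.1) hp
        exact p.1.1.2 this
    · unfold mergeRel; grind
    · unfold mergeRel; grind
  have hcard : Fintype.card X = Fintype.card {x : X // x ≠ b} + 1 := by
    have := Fintype.card_pos_iff.2 ⟨b⟩
    simp
    omega
  refine ⟨P₁ + P₂ + P₃, fun n => ⟨?_, ?_⟩⟩
  · rw [card_strictColoring_split r hirr htrans hab, eval_add, eval_add, (h₁ n).1, (h₂ n).1, (h₃ n).1]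
    push_cast
    ring
  · have h : (Nat.card (WeakColoring r n) : K) + Nat.card (WeakColoring (mergeRel r a b) n) =
      Nat.card (WeakColoring (addRel r a b) n) + Nat.card (WeakColoring (addRel r b a) n) := by
      exact_mod_cast card_weakColoring_split r htrans hab n
    rw [eval_add, eval_add, (h₁ n).2, (h₂ n).2, (h₃ n).2, eq_sub_of_add_eq h, hcard, pow_succ]
    ring

/-- Reciprocity for the order polynomial of a finite poset. -/
theorem exists_orderPolynomial {K : Type*} [Field K] [CharZero K] {X : Type*} [Fintype X]
    (r : X → X → Prop)
    (hirr : ∀ u, ¬ r u u) (htrans : ∀ u v w, r u v → r v w → r u w) :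
    ∃ P : K[X], ∀ n : ℕ, P.eval (n : K) = (Nat.card (StrictColoring r n) : K) ∧
      P.eval (-(n : K)) = (-1) ^ Fintype.card X * (Nat.card (WeakColoring r n) : K) :=
  exists_orderPolynomial_aux _ r hirr htrans rfl

end OrderPolynomial

/-! ### Acyclic orientations, colorings and the poset of components. -/

section OrientationColoring
variable {α : Type*} [DecidableEq α] {V : Finset α} {h : SimpleHypergraph V}

/-- Loops can be cut out of a walk. This supplies the distinct edges that the definition of a
directed cycle demands. -/
theorem exists_nodup_isChain_of_reflTransGen {β : Type*} {S : β → β → Prop} {a b : β}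
    (hab : Relation.ReflTransGen S a b) :
    ∃ l : List β, (a :: l).IsChain S ∧ (a :: l).Nodup ∧
      (a :: l).getLast (List.cons_ne_nil a l) = b := by
  induction hab using Relation.ReflTransGen.head_induction_on with
  | refl => exact ⟨[], by simp⟩
  | @head a c hac _ ih =>
    obtain ⟨l, hl, hn, hlast⟩ := ih
    by_cases ha : a ∈ c :: l
    · obtain ⟨s, t, hst⟩ := List.append_of_mem ha
      have hsuf : a :: t <:+ c :: l := ⟨s, hst.symm⟩
      refine ⟨t, hl.suffix hsuf, hn.sublist hsuf.sublist, ?_⟩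
      rw [← hlast, ← List.IsSuffix.getLast hsuf]
    · refine ⟨c :: l, ?_, ?_, ?_⟩
      · exact List.isChain_cons_cons.2 ⟨hac, hl⟩
      · exact List.nodup_cons.2 ⟨ha, hn⟩
      · rw [List.getLast_cons_cons, hlast]

namespace AcyclicOrientation

theorem exists_mem (f : AcyclicOrientation h) (e : h.edges) : ∃ v : V, v.1 ∈ f.toFun e := by
  obtain ⟨v, hv⟩ := f.nonempty e
  exact ⟨⟨v, h.subset_of_mem e.1 e.2 (f.subset e hv)⟩, hv⟩

theorem ext_mem {f f' : AcyclicOrientation h}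
    (H : ∀ (e : h.edges) (v : V), v.1 ∈ f.toFun e ↔ v.1 ∈ f'.toFun e) : f = f' := by
  have : f.toFun = f'.toFun := by
    funext e
    ext v
    constructor
    · intro hv
      exact (H e ⟨v, h.subset_of_mem e.1 e.2 (f.subset e hv)⟩).1 hv
    · intro hv
      exact (H e ⟨v, h.subset_of_mem e.1 e.2 (f'.subset e hv)⟩).2 hv
  cases f
  cases f'
  congr

/-- The relation generated by an orientation, pointing towards the elements of `f e`. -/
def Step (f : AcyclicOrientation h) (u v : V) : Prop :=
  ∃ e : h.edges, u.1 ∈ e.1 ∧ v.1 ∈ f.toFun e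

/-- The reflexive transitive closure of `Step`. -/
def Reach (f : AcyclicOrientation h) : V → V → Prop := Relation.ReflTransGen f.Step

/-- The orientation of a hypergraph given by the vertices of maximal color. -/
noncomputable def ofColoring (h : SimpleHypergraph V) {n : ℕ} (c : V → Fin n) :
    AcyclicOrientation h := by
  classical
  exact
  { toFun := fun e => (Finset.univ.filter fun v : V => IsMaximalIn c e.1 v).map
      (Function.Embedding.subtype _)
    nonempty := by
      intro e
      obtain ⟨x, hx⟩ := h.nonempty_of_mem e.1 e.2
      obtain ⟨v, hv, hmax⟩ := Finset.exists_max_image (Finset.univ.filter fun v : V => v.1 ∈ e.1) c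
        ⟨⟨x, h.subset_of_mem e.1 e.2 hx⟩, by simpa using hx⟩
      refine ⟨v.1, Finset.mem_map.2 ⟨v, ?_, rfl⟩⟩
      simp only [Finset.mem_filter, Finset.mem_univ, true_and] at hv hmax ⊢
      exact ⟨hv, hmax⟩
    subset := by
      intro e x hx
      obtain ⟨v, hv, rfl⟩ := Finset.mem_map.1 hx
      exact (Finset.mem_filter.1 hv).2.1
    acyclic := by
      rintro ⟨k, e, -, hstep, hlast⟩
      have hmem : ∀ (x : α) (i : Fin (k + 1)),
          x ∈ (Finset.univ.filter fun v : V => IsMaximalIn c (e i).1 v).map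
            (Function.Embedding.subtype _) ↔ ∃ v : V, v.1 = x ∧ IsMaximalIn c (e i).1 v := by
        intro x i
        simp [and_comm]
      simp only [Finset.Nonempty, Finset.mem_inter, Finset.mem_sdiff, hmem,
        Finset.ssubset_iff_subset_ne] at hstep hlast
      obtain ⟨_, ⟨w, rfl, hw⟩, hw0, hwn⟩ := hlast
      -- The vertex w is not maximal in the first edge, and the maximal color never drops along the
      -- path. At the last edge w itself is maximal, a contradiction.
      have key : ∀ i (u : V), IsMaximalIn c (e i).1 u → c w < c u := by
        intro i
        induction i using Fin.induction with
        | zero =>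
          intro u hu
          by_contra hcon
          exact hwn ⟨w, rfl, hw0, fun x hx => (hu.2 x hx).trans (not_lt.1 hcon)⟩
        | succ i ih =>
          intro u hu
          rcases hstep i with ⟨_, ⟨v, rfl, hv⟩, hv', -⟩ | ⟨⟨_, ⟨v, rfl, hv⟩, hv'⟩, -⟩
          · exact (ih v hv).trans_le (hu.2 v hv')
          · exact (ih v hv).trans_le (hu.2 v hv')
      exact lt_irrefl _ (key _ w hw) }

theorem mem_ofColoring {n : ℕ} (c : V → Fin n) (e : h.edges) (v : V) :
    v.1 ∈ (ofColoring h c).toFun e ↔ IsMaximalIn c e.1 v := by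
  simp [ofColoring]

theorem strictlyCompatible_ofColoring {n : ℕ} (c : V → Fin n) :
    StrictlyCompatible (ofColoring h c) c :=
  fun e v => mem_ofColoring c e v

theorem strictlyCompatible_iff_eq_ofColoring {n : ℕ} (c : V → Fin n) (f : AcyclicOrientation h) :
    StrictlyCompatible f c ↔ f = ofColoring h c := by
  refine ⟨fun hf => ext_mem fun e v => ?_, ?_⟩
  · rw [hf e v, mem_ofColoring]
  · rintro rfl
    exact strictlyCompatible_ofColoring c

theorem compatible_iff {n : ℕ} (c : V → Fin n) (f : AcyclicOrientation h) :
    Compatible f c ↔ ∀ u v, f.Step u v → c u ≤ c v := by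
  constructor
  · rintro H u v ⟨e, hu, hv⟩
    exact (H e v hv).2 u hu
  · intro H e v hv
    exact ⟨f.subset e hv, fun w hw => H w v ⟨e, hw, hv⟩⟩

theorem strictlyCompatible_iff {n : ℕ} (c : V → Fin n) (f : AcyclicOrientation h) :
    StrictlyCompatible f c ↔ Compatible f c ∧
      ∀ (e : h.edges) (u v : V), u.1 ∈ e.1 → u.1 ∉ f.toFun e → v.1 ∈ f.toFun e → c u < c v := by
  constructor
  · intro H
    refine ⟨fun e v hv => (H e v).1 hv, fun e u v hu hun hv => ?_⟩
    by_contra hcon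
    refine hun ((H e u).2 ⟨hu, fun w hw => ?_⟩)
    exact (((H e v).1 hv).2 w hw).trans (not_lt.1 hcon)
  · rintro ⟨H, H'⟩ e v
    refine ⟨H e v, fun hv => ?_⟩
    by_contra hvn
    obtain ⟨w, hw⟩ := f.exists_mem e
    exact absurd (hv.2 w (f.subset e hw)) (not_le.2 (H' e v w hv.1 hvn hw))

/-- The relation between consecutive edges of a directed path. -/
def EdgeStep (f : AcyclicOrientation h) (e e' : h.edges) : Prop :=
  (f.toFun e ∩ (e'.1 \ f.toFun e')).Nonempty ∨
    ((f.toFun e ∩ e'.1).Nonempty ∧ f.toFun e ∩ e'.1 ⊂ f.toFun e')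

/-- Acyclicity without the distinctness clause: a walk of edges shortens to a repetition-free one
with the same ends. -/
theorem not_reflTransGen_edgeStep (f : AcyclicOrientation h) {e e' : h.edges}
    (H : Relation.ReflTransGen f.EdgeStep e e') :
    ¬ (f.toFun e' ∩ (e.1 \ f.toFun e)).Nonempty := by
  intro hne
  obtain ⟨l, hl, hn, hlast⟩ := exists_nodup_isChain_of_reflTransGen H
  refine f.acyclic ⟨l.length, (e :: l).get, List.nodup_iff_injective_get.1 hn, ?_, ?_⟩
  · intro i
    exact List.isChain_iff_getElem.1 hl i (by simp)
  · rw [List.getLast_eq_getElem] at hlast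
    have : (e :: l).get (Fin.last l.length) = e' := hlast
    rw [this]
    exact hne

/-- In an acyclic orientation of a graph, no directed edge can be closed to a cycle. -/
theorem not_reach_of_card_two (h2 : ∀ e ∈ h.edges, e.card = 2) (f : AcyclicOrientation h)
    {e : h.edges} {u v : V} (hu : u.1 ∈ e.1) (hun : u.1 ∉ f.toFun e) (hv : v.1 ∈ f.toFun e) :
    ¬ f.Reach v u := by
  intro H
  -- The vertex path is lifted to a path of edges from e, keeping the current vertex in the head of
  -- the current edge.
  have key : ∀ w, f.Reach v w →
      ∃ e', Relation.ReflTransGen f.EdgeStep e e' ∧ w.1 ∈ f.toFun e' := by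
    intro w hw
    induction hw with
    | refl => exact ⟨e, .refl, hv⟩
    | @tail w x hw hx ih =>
      obtain ⟨e', he', hwe'⟩ := ih
      obtain ⟨e'', hwe'', hxe''⟩ := hx
      by_cases hwx : w = x
      · exact ⟨e', he', hwx ▸ hwe'⟩
      by_cases hee : e' = e''
      · exact ⟨e', he', hee ▸ hxe''⟩
      refine ⟨e'', he'.tail ?_, hxe''⟩
      by_cases hw' : w.1 ∈ f.toFun e''
      · refine Or.inr ⟨⟨w.1, Finset.mem_inter.2 ⟨hwe', hwe''⟩⟩, ?_⟩
        have hpair : ({w.1, x.1} : Finset α).card = 2 :=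
          Finset.card_pair fun hc => hwx (Subtype.ext hc)
        -- Both ends of e'' are heads, so the second alternative of `EdgeStep` applies: distinct
        -- two-element edges are not nested, hence f(e') misses part of e''.
        have h1 : f.toFun e'' = e''.1 := by
          refine Finset.eq_of_subset_of_card_le (f.subset e'') ?_
          rw [h2 e'' e''.2, ← hpair]
          exact Finset.card_le_card (by simp [Finset.insert_subset_iff, hw', hxe''])
        rw [h1, Finset.ssubset_iff_subset_ne]
        refine ⟨Finset.inter_subset_right, fun hc => hee (Subtype.ext ?_)⟩
        refine (Finset.eq_of_subset_of_card_le ?_ ?_).symm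
        · exact (Finset.inter_eq_right.1 hc).trans (f.subset e')
        · rw [h2 e' e'.2, h2 e'' e''.2]
      · exact Or.inl ⟨w.1, Finset.mem_inter.2 ⟨hwe', Finset.mem_sdiff.2 ⟨hwe'', hw'⟩⟩⟩
  obtain ⟨e', he', hue'⟩ := key u H
  exact f.not_reflTransGen_edgeStep he'
    ⟨u.1, Finset.mem_inter.2 ⟨hue', Finset.mem_sdiff.2 ⟨hu, hun⟩⟩⟩

/-- Each vertex is colored by the number of vertices reaching it. Along an oriented edge from u to v
this number grows strictly, since v reaches itself but not u. -/
theorem exists_strictlyCompatible (h2 : ∀ e ∈ h.edges, e.card = 2) (f : AcyclicOrientation h) :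
    ∃ (n : ℕ) (c : V → Fin n), StrictlyCompatible f c := by
  classical
  let D : V → Finset V := fun v => Finset.univ.filter fun u => f.Reach u v
  refine ⟨Fintype.card V + 1, fun v => ⟨(D v).card, Nat.lt_succ_of_le (Finset.card_le_univ _)⟩, ?_⟩
  have hle : ∀ u v, f.Step u v → D u ⊆ D v := by
    intro u v huv w hw
    simp only [D, Finset.mem_filter, Finset.mem_univ, true_and] at hw ⊢
    exact hw.tail huv
  rw [strictlyCompatible_iff, compatible_iff]
  refine ⟨fun u v huv => Finset.card_le_card (hle u v huv), fun e u v hu hun hv => ?_⟩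
  refine Finset.card_lt_card ((Finset.ssubset_iff_of_subset (hle u v ⟨e, hu, hv⟩)).2 ⟨v, ?_, ?_⟩)
  · simp only [D, Finset.mem_filter, Finset.mem_univ, true_and]
    exact .refl
  · simp only [D, Finset.mem_filter, Finset.mem_univ, true_and]
    exact f.not_reach_of_card_two h2 hu hun hv

theorem reach_of_reachable (f : AcyclicOrientation h) {u v : V}
    (H : f.image.toGraph.Reachable u v) : f.Reach u v := by
  obtain ⟨p⟩ := H
  induction p with
  | nil => exact .refl
  | cons hadj _ ih =>
    refine .head ?_ ih
    obtain ⟨-, ⟨_, ⟨e, rfl⟩, h1, h2⟩ | ⟨_, ⟨e, rfl⟩, h1, h2⟩⟩ := hadj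
    · exact ⟨e, f.subset e h1, h2⟩
    · exact ⟨e, f.subset e h2, h1⟩

/-- The strict order induced on the components of the unoriented part. -/
def componentRel (f : AcyclicOrientation h) (x y : f.image.toGraph.ConnectedComponent) : Prop :=
  ∃ u v, f.image.toGraph.connectedComponentMk u = x ∧ f.image.toGraph.connectedComponentMk v = y ∧
    f.Reach u v ∧ ¬ f.Reach v u

theorem componentRel_irrefl (f : AcyclicOrientation h) (x) : ¬ f.componentRel x x := by
  rintro ⟨u, v, rfl, hv, -, hn⟩
  exact hn (f.reach_of_reachable (SimpleGraph.ConnectedComponent.exact hv))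

theorem componentRel_trans (f : AcyclicOrientation h) (x y z) (hxy : f.componentRel x y)
    (hyz : f.componentRel y z) : f.componentRel x z := by
  obtain ⟨u, v, rfl, rfl, h1, h2⟩ := hxy
  obtain ⟨v', w, hv, rfl, h3, h4⟩ := hyz
  have hv' := SimpleGraph.ConnectedComponent.exact hv
  have h5 := f.reach_of_reachable hv'
  have h6 := f.reach_of_reachable hv'.symm
  exact ⟨u, w, rfl, rfl, (h1.trans h6).trans h3, fun h7 => h4 ((h7.trans h1).trans h6)⟩

theorem Reach.le {f : AcyclicOrientation h} {n : ℕ} {c : V → Fin n} (hc : Compatible f c) {u v : V}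
    (H : f.Reach u v) : c u ≤ c v := by
  rw [compatible_iff] at hc
  induction H with
  | refl => exact le_rfl
  | tail _ h1 ih => exact ih.trans (hc _ _ h1)

/-- Either some step of the path leaves a vertex outside the head of its edge and the color jumps,
or every step is reversible. -/
theorem Reach.lt {f : AcyclicOrientation h} {n : ℕ} {c : V → Fin n} (hc : StrictlyCompatible f c)
    {u v : V} (H : f.Reach u v) (Hn : ¬ f.Reach v u) : c u < c v := by
  have hcomp := ((strictlyCompatible_iff c f).1 hc).1
  have key : c u < c v ∨ f.Reach v u := by
    clear Hn
    induction H with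
    | refl => exact Or.inr .refl
    | @tail w x h1 h2 ih =>
      have hle := (compatible_iff c f).1 hcomp _ _ h2
      obtain ⟨e, hw, hx⟩ := h2
      by_cases hwf : w.1 ∈ f.toFun e
      · rcases ih with ih | ih
        · exact Or.inl (ih.trans_le hle)
        · exact Or.inr (.head ⟨e, f.subset e hx, hwf⟩ ih)
      · exact Or.inl ((Reach.le hcomp h1).trans_lt
          (((strictlyCompatible_iff c f).1 hc).2 e w x hw hwf hx))
  exact key.resolve_right Hn

theorem eq_of_connectedComponentMk_eq {f : AcyclicOrientation h} {n : ℕ} {c : V → Fin n}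
    (hc : Compatible f c) {u v : V}
    (H : f.image.toGraph.connectedComponentMk u = f.image.toGraph.connectedComponentMk v) :
    c u = c v := by
  have := SimpleGraph.ConnectedComponent.exact H
  exact le_antisymm (Reach.le hc (f.reach_of_reachable this))
    (Reach.le hc (f.reach_of_reachable this.symm))

theorem connectedComponentMk_eq_of_mem (f : AcyclicOrientation h) {e : h.edges} {u v : V}
    (hu : u.1 ∈ f.toFun e) (hv : v.1 ∈ f.toFun e) :
    f.image.toGraph.connectedComponentMk u = f.image.toGraph.connectedComponentMk v := by
  by_cases huv : u = v
  · rw [huv]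
  · exact SimpleGraph.ConnectedComponent.sound
      (SimpleGraph.Adj.reachable ⟨huv, Or.inl ⟨_, ⟨e, rfl⟩, hu, hv⟩⟩)

theorem compatible_comp_iff (h2 : ∀ e ∈ h.edges, e.card = 2) (f : AcyclicOrientation h) {n : ℕ}
    (d : f.image.toGraph.ConnectedComponent → Fin n) :
    Compatible f (d ∘ f.image.toGraph.connectedComponentMk) ↔
      ∀ x y, f.componentRel x y → d x ≤ d y := by
  constructor
  · rintro H _ _ ⟨u, v, rfl, rfl, huv, -⟩
    exact Reach.le H huv
  · intro H
    rw [compatible_iff]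
    rintro u v ⟨e, hu, hv⟩
    by_cases huf : u.1 ∈ f.toFun e
    · exact (congrArg d (f.connectedComponentMk_eq_of_mem huf hv)).le
    · exact H _ _ ⟨u, v, rfl, rfl, .single ⟨e, hu, hv⟩, f.not_reach_of_card_two h2 hu huf hv⟩

theorem strictlyCompatible_comp_iff (h2 : ∀ e ∈ h.edges, e.card = 2) (f : AcyclicOrientation h)
    {n : ℕ} (d : f.image.toGraph.ConnectedComponent → Fin n) :
    StrictlyCompatible f (d ∘ f.image.toGraph.connectedComponentMk) ↔
      ∀ x y, f.componentRel x y → d x < d y := by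
  constructor
  · rintro H _ _ ⟨u, v, rfl, rfl, huv, hn⟩
    exact Reach.lt H huv hn
  · intro H
    rw [strictlyCompatible_iff, compatible_comp_iff h2]
    refine ⟨fun x y hxy => (H x y hxy).le, fun e u v hu hun hv => ?_⟩
    exact H _ _ ⟨u, v, rfl, rfl, .single ⟨e, hu, hv⟩, f.not_reach_of_card_two h2 hu hun hv⟩

/-- Compatible colorings are constant on components, so they descend uniquely to the set of
components. -/
theorem card_subtype_comp_connectedComponentMk (f : AcyclicOrientation h) {n : ℕ}
    {p : (V → Fin n) → Prop} {q : (f.image.toGraph.ConnectedComponent → Fin n) → Prop}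
    (hp : ∀ c, p c → Compatible f c)
    (hpq : ∀ d, p (d ∘ f.image.toGraph.connectedComponentMk) ↔ q d) :
    Nat.card {c // p c} = Nat.card {d // q d} := by
  symm
  refine Nat.card_congr (Equiv.ofBijective
    (fun d => ⟨d.1 ∘ f.image.toGraph.connectedComponentMk, (hpq d.1).2 d.2⟩) ⟨?_, ?_⟩)
  · intro d d' hdd
    have := congrArg Subtype.val hdd
    refine Subtype.ext (funext fun x => ?_)
    induction x using SimpleGraph.ConnectedComponent.ind with
    | _ v => exact congrFun this v
  · rintro ⟨c, hc⟩
    let d : f.image.toGraph.ConnectedComponent → Fin n :=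
      Quot.lift c fun u v huv => eq_of_connectedComponentMk_eq (hp c hc) (Quot.sound huv)
    exact ⟨⟨d, (hpq d).1 hc⟩, rfl⟩

theorem exists_coloringPolynomial (K : Type*) [Field K] [CharZero K]
    (h2 : ∀ e ∈ h.edges, e.card = 2) (f : AcyclicOrientation h) :
    ∃ P : Polynomial K, ∀ n : ℕ,
      P.eval (n : K) = (Nat.card {c : V → Fin n // StrictlyCompatible f c} : K) ∧
      P.eval (-(n : K)) =
        (-1) ^ f.image.cc * (Nat.card {c : V → Fin n // Compatible f c} : K) := by
  classical
  obtain ⟨P, hP⟩ := exists_orderPolynomial (K := K) f.componentRel f.componentRel_irrefl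
    f.componentRel_trans
  refine ⟨P, fun n => ⟨?_, ?_⟩⟩
  · rw [(hP n).1, f.card_subtype_comp_connectedComponentMk
      (fun c hc => ((strictlyCompatible_iff c f).1 hc).1) (f.strictlyCompatible_comp_iff h2)]
    rfl
  · rw [(hP n).2, ← Nat.card_eq_fintype_card, f.card_subtype_comp_connectedComponentMk (fun c hc => hc)
      (f.compatible_comp_iff h2), SimpleHypergraph.cc]
    rfl

end AcyclicOrientation
end OrientationColoring

/-! ### Orientations of a complex and of its 1-skeleton. -/

section Complexes
variable {α : Type*} {V : Finset α} {C : SComplex V}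

theorem SComplex.card_of_mem_skeleton (C : SComplex V) :
    ∀ e ∈ C.skeleton.edges, e.card = 2 :=
  fun _ he => he.2

theorem SComplex.ext_faces {C C' : SComplex V} (H : ∀ e, e ∈ C.faces ↔ e ∈ C'.faces) : C = C' :=
  SComplex.ext (Set.ext H)

/-- The color classes of a coloring. -/
def colorClass {n : ℕ} (c : V → Fin n) (i : Fin n) : Finset α :=
  (Finset.univ.filter fun v => c v = i).map (Function.Embedding.subtype _)

theorem mem_colorClass {n : ℕ} (c : V → Fin n) (i : Fin n) (x : α) :
    x ∈ colorClass c i ↔ ∃ hx : x ∈ V, c ⟨x, hx⟩ = i := by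
  simp [colorClass]

variable [DecidableEq α]

theorem SComplex.mem_skeleton_of_mem {e : Finset α} (he : e ∈ C.faces) {v w : α} (hv : v ∈ e)
    (hw : w ∈ e) (hwv : w ≠ v) : {v, w} ∈ C.skeleton.edges := by
  refine ⟨(C.isRelLowerSet_faces he).2 ?_ ⟨v, by simp⟩, Finset.card_pair hwv.symm⟩
  simp [Finset.insert_subset_iff, hv, hw]

namespace AcyclicOrientation

/-- The restriction of an orientation of a complex to the 1-skeleton. -/
def restrictSkeleton (f : AcyclicOrientation C.toHypergraph) : AcyclicOrientation C.skeleton where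
  toFun e := f.toFun ⟨e.1, e.2.1⟩
  nonempty _ := f.nonempty _
  subset _ := f.subset _
  acyclic := by
    rintro ⟨k, e, he, h1, h2⟩
    refine f.acyclic ⟨k, fun i => ⟨(e i).1, (e i).2.1⟩, fun i j hij => he ?_, h1, h2⟩
    exact Subtype.ext (congrArg (fun x => x.1) hij)

/-- A failure in either direction produces a directed cycle of length 2 between e and some pair {v,
w}. -/
theorem mem_iff_restrictSkeleton (f : AcyclicOrientation C.toHypergraph)
    (e : C.toHypergraph.edges) (v : α) :
    v ∈ f.toFun e ↔ v ∈ e.1 ∧ ∀ w ∈ e.1, w ≠ v →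
      ∃ hp : {v, w} ∈ C.skeleton.edges, v ∈ f.restrictSkeleton.toFun ⟨{v, w}, hp⟩ := by
  have two : ∀ e₁ e₂ : C.toHypergraph.edges, f.EdgeStep e₁ e₂ →
      ¬ (f.toFun e₂ ∩ (e₁.1 \ f.toFun e₁)).Nonempty :=
    fun e₁ e₂ h12 => f.not_reflTransGen_edgeStep (.single h12)
  constructor
  · intro hv
    refine ⟨f.subset e hv, fun w hw hwv => ?_⟩
    have hp := SComplex.mem_skeleton_of_mem e.2 (f.subset e hv) hw hwv
    refine ⟨hp, ?_⟩
    by_contra hvn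
    change v ∉ f.toFun ⟨{v, w}, hp.1⟩ at hvn
    have hfw : f.toFun ⟨{v, w}, hp.1⟩ = {w} := by
      refine (Finset.Nonempty.subset_singleton_iff (f.nonempty _)).1 fun x hx => ?_
      have := f.subset _ hx
      simp only [Finset.mem_insert, Finset.mem_singleton] at this ⊢
      rcases this with rfl | rfl
      · exact absurd hx hvn
      · rfl
    -- The cycle goes from {v, w} to e through w and returns through v.
    refine two ⟨{v, w}, hp.1⟩ e ?_ ⟨v, ?_⟩
    · have hwe : ({w} : Finset α) ∩ e.1 = {w} := by simpa using hw
      unfold EdgeStep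
      rw [hfw, hwe]
      by_cases hwf : w ∈ f.toFun e
      · refine Or.inr ⟨⟨w, by simp⟩, ?_⟩
        refine (Finset.ssubset_iff_of_subset (by simpa using hwf)).2 ⟨v, hv, ?_⟩
        simpa using hwv.symm
      · exact Or.inl ⟨w, by simp [hw, hwf]⟩
    · simp [hv, hvn]
  · rintro ⟨hve, H⟩
    by_contra hv
    obtain ⟨w, hw⟩ := f.nonempty e
    have hwv : w ≠ v := by
      rintro rfl
      exact hv hw
    obtain ⟨hp, hvp⟩ := H w (f.subset e hw) hwv
    change v ∈ f.toFun ⟨{v, w}, hp.1⟩ at hvp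
    -- Here the cycle goes from e to {v, w} through w and returns through v.
    refine two e ⟨{v, w}, hp.1⟩ ?_ ⟨v, by simp [hvp, hve, hv]⟩
    have hin : f.toFun e ∩ {v, w} = {w} := by
      ext x
      simp only [Finset.mem_inter, Finset.mem_insert, Finset.mem_singleton]
      constructor
      · rintro ⟨hx, rfl | rfl⟩
        · exact absurd hx hv
        · rfl
      · rintro rfl
        exact ⟨hw, Or.inr rfl⟩
    by_cases hwp : w ∈ f.toFun ⟨{v, w}, hp.1⟩
    · refine Or.inr ⟨⟨w, by simp [hw]⟩, ?_⟩
      change f.toFun e ∩ {v, w} ⊂ _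
      rw [hin]
      refine (Finset.ssubset_iff_of_subset (by simpa using hwp)).2 ⟨v, hvp, ?_⟩
      simpa using hwv.symm
    · exact Or.inl ⟨w, by simp [hw, hwp]⟩

theorem restrictSkeleton_injective :
    Function.Injective (restrictSkeleton : AcyclicOrientation C.toHypergraph → _) := by
  intro f f' hff
  refine ext_mem fun e v => ?_
  rw [mem_iff_restrictSkeleton, mem_iff_restrictSkeleton, hff]

theorem restrictSkeleton_ofColoring {n : ℕ} (c : V → Fin n) :
    (ofColoring C.toHypergraph c).restrictSkeleton = ofColoring C.skeleton c :=
  (strictlyCompatible_iff_eq_ofColoring c _).1 fun e v =>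
    strictlyCompatible_ofColoring (h := C.toHypergraph) c ⟨e.1, e.2.1⟩ v

/-- A coloring inducing f on the skeleton also induces an orientation of the whole complex, which
restricts to f. -/
theorem restrictSkeleton_surjective :
    Function.Surjective (restrictSkeleton : AcyclicOrientation C.toHypergraph → _) := by
  intro f
  obtain ⟨n, c, hc⟩ := f.exists_strictlyCompatible C.card_of_mem_skeleton
  exact ⟨ofColoring C.toHypergraph c, by
    rw [restrictSkeleton_ofColoring, (strictlyCompatible_iff_eq_ofColoring c f).1 hc]⟩

variable (C) in
/-- Restriction to the 1-skeleton is a bijection on acyclic orientations. -/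
noncomputable def restrictEquiv :
    AcyclicOrientation C.toHypergraph ≃ AcyclicOrientation C.skeleton :=
  Equiv.ofBijective restrictSkeleton ⟨restrictSkeleton_injective, restrictSkeleton_surjective⟩

theorem strictlyCompatible_restrictSkeleton {n : ℕ} (f : AcyclicOrientation C.toHypergraph)
    (c : V → Fin n) : StrictlyCompatible f.restrictSkeleton c ↔ StrictlyCompatible f c := by
  rw [strictlyCompatible_iff_eq_ofColoring, strictlyCompatible_iff_eq_ofColoring,
    ← restrictSkeleton_ofColoring, restrictSkeleton_injective.eq_iff]

theorem compatible_restrictSkeleton {n : ℕ} (f : AcyclicOrientation C.toHypergraph)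
    (c : V → Fin n) : Compatible f.restrictSkeleton c ↔ Compatible f c := by
  refine ⟨fun H e v hv => ⟨f.subset e hv, fun w hw => ?_⟩, fun H e v hv => H ⟨e.1, e.2.1⟩ v hv⟩
  by_cases hwv : w = v
  · rw [hwv]
  · obtain ⟨hp, hvp⟩ := ((f.mem_iff_restrictSkeleton e v).1 hv).2 w hw
      fun hc => hwv (Subtype.ext hc)
    exact (H ⟨_, hp⟩ v hvp).2 w (by simp)

/-- By the pairwise test, two vertices of some f(e) are both in the head of their own pair. Thus
f(g) and f(C) have the same components. -/
theorem toGraph_image_restrictSkeleton (f : AcyclicOrientation C.toHypergraph) :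
    f.restrictSkeleton.image.toGraph = f.imageComplex.toHypergraph.toGraph := by
  unfold SimpleHypergraph.toGraph
  ext v w
  simp only [SimpleGraph.fromRel_adj]
  refine and_congr_right fun hvw => ?_
  have key : ∀ v w : V, v ≠ w → ((∃ e ∈ f.restrictSkeleton.image.edges, v.1 ∈ e ∧ w.1 ∈ e) ↔
      ∃ e ∈ f.imageComplex.toHypergraph.edges, v.1 ∈ e ∧ w.1 ∈ e) := by
    intro v w hvw
    constructor
    · rintro ⟨_, ⟨e, rfl⟩, hv, hw⟩
      exact ⟨_, ⟨⟨e.1, e.2.1⟩, rfl⟩, hv, hw⟩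
    · rintro ⟨_, ⟨e, rfl⟩, hv, hw⟩
      obtain ⟨hp, hvp⟩ := ((f.mem_iff_restrictSkeleton e v).1 hv).2 w (f.subset e hw)
        fun hc => hvw (Subtype.ext hc).symm
      obtain ⟨hp', hwp⟩ := ((f.mem_iff_restrictSkeleton e w).1 hw).2 v (f.subset e hv)
        fun hc => hvw (Subtype.ext hc)
      refine ⟨_, ⟨⟨_, hp⟩, rfl⟩, hvp, ?_⟩
      have : (⟨{v.1, w.1}, hp⟩ : C.skeleton.edges) = ⟨{w.1, v.1}, hp'⟩ :=
        Subtype.ext (Finset.pair_comm _ _)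
      rw [this]
      exact hwp
  rw [key v w hvw, key w v hvw.symm]

end AcyclicOrientation

/-! ### The invariant as a sum over colorings. -/

/-- The faces of a complex contained in one of the given sets. -/
def SComplex.parts (C : SComplex V) {n : ℕ} (D : Fin n → Finset α) : SComplex V where
  faces := {e | e ∈ C.faces ∧ ∃ i, e ⊆ D i}
  isRelLowerSet_faces := fun _ he =>
    ⟨(C.isRelLowerSet_faces he.1).1, fun _ hba hb =>
      ⟨(C.isRelLowerSet_faces he.1).2 hba hb, he.2.imp fun _ hi => Finset.Subset.trans hba hi⟩⟩
  subset_of_mem := fun e he => C.subset_of_mem e he.1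

variable (K : Type*) [Field K]

/-- Since C is closed under non-empty subsets, each e ∩ V₂ in the contraction is already a face, so
contracting keeps just the faces inside the last part. -/
theorem productCoproduct_basisElem (n : ℕ) : ∀ (V : Finset α) (D : Fin n → Finset α)
    (h : IsDecomposition V D) (C : SComplex V),
    productCoproduct K n V D h (basisElem K C) = basisElem K (C.parts D) := by
  induction n with
  | zero =>
    intro V D h C
    have hV : V = ∅ := by rw [← h.union_eq]; simp
    have : C.parts D = C := by
      refine SComplex.ext_faces fun e => ⟨fun he => he.1, fun he => ?_⟩
      obtain ⟨x, hx⟩ := (C.isRelLowerSet_faces he).1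
      have := C.subset_of_mem e he hx
      simp [hV] at this
    rw [this]
    rfl
  | succ n ih =>
    intro V D h C
    have h1 : coproduct K h.isSplit (basisElem K C) =
        basisElem K (C.restrict _) ⊗ₜ[K] basisElem K (C.contract h.isSplit) := by
      simp [coproduct]
    have h2 : ∀ (C₁ : SComplex _) (C₂ : SComplex _),
        product K h.isSplit (basisElem K C₁ ⊗ₜ[K] basisElem K C₂) =
          basisElem K (C₁.disjUnion h.isSplit C₂) := by
      intro C₁ C₂
      simp [product]
    rw [productCoproduct, LinearMap.comp_apply, LinearMap.comp_apply, h1, TensorProduct.map_tmul,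
      ih, LinearMap.id_apply, h2]
    congr 1
    refine SComplex.ext_faces fun e => ⟨?_, ?_⟩
    · rintro (⟨⟨he, -⟩, i, hi⟩ | ⟨e', he', hne, rfl⟩)
      · exact ⟨he, i.castSucc, hi⟩
      · refine ⟨(C.isRelLowerSet_faces he').2 Finset.inter_subset_left ?_,
          Fin.last n, Finset.inter_subset_right⟩
        exact ((C.contract h.isSplit).isRelLowerSet_faces ⟨e', he', hne, rfl⟩).1
    · rintro ⟨he, i, hi⟩
      induction i using Fin.lastCases with
      | last =>
        refine Or.inr ⟨e, he, fun hc => ?_, (Finset.inter_eq_left.2 hi).symm⟩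
        obtain ⟨x, hx⟩ := (C.isRelLowerSet_faces he).1
        exact Finset.disjoint_left.1 h.isSplit.disjoint (hc hx) (hi hx)
      | cast i =>
        exact Or.inl ⟨⟨he, hi.trans (Finset.subset_biUnion_of_mem (Fin.init D)
          (Finset.mem_univ i))⟩, i, hi⟩

theorem isDecomposition_colorClass {n : ℕ} (c : V → Fin n) : IsDecomposition V (colorClass c) where
  disjoint := by
    intro i j hij
    rw [Finset.disjoint_left]
    intro x hx hx'
    obtain ⟨h1, h2⟩ := (mem_colorClass c i x).1 hx
    obtain ⟨h3, h4⟩ := (mem_colorClass c j x).1 hx'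
    exact hij (h2.symm.trans h4)
  union_eq := by
    ext x
    simp [mem_colorClass]

theorem colorClass_bijective (V : Finset α) (n : ℕ) :
    Function.Bijective fun c : V → Fin n =>
      (⟨colorClass c, isDecomposition_colorClass c⟩ :
        {D : Fin n → Finset α // IsDecomposition V D}) := by
  constructor
  · intro c c' hcc
    have h : colorClass c = colorClass c' := congrArg Subtype.val hcc
    funext v
    have hv : v.1 ∈ colorClass c (c v) := (mem_colorClass _ _ _).2 ⟨v.2, rfl⟩
    rw [h] at hv
    exact ((mem_colorClass _ _ _).1 hv).2.symm
  · rintro ⟨D, hD⟩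
    have hex : ∀ v : V, ∃ i, v.1 ∈ D i := by
      intro v
      have hv : v.1 ∈ Finset.univ.biUnion D := hD.union_eq.symm ▸ v.2
      simpa using hv
    choose c hc using hex
    refine ⟨c, Subtype.ext (funext fun i => Finset.ext fun x => ?_)⟩
    rw [mem_colorClass]
    constructor
    · rintro ⟨hx, rfl⟩
      exact hc ⟨x, hx⟩
    · intro hx
      have hxV : x ∈ V := by
        rw [← hD.union_eq]
        exact Finset.mem_biUnion.2 ⟨i, Finset.mem_univ i, hx⟩
      refine ⟨hxV, ?_⟩
      by_contra hne
      exact Finset.disjoint_left.1 (hD.disjoint hne) (hc ⟨x, hxV⟩) hx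

/-- A monochromatic face is its own set of maximal vertices; conversely, the maximal vertices of a
face form a monochromatic face. -/
theorem parts_colorClass (C : SComplex V) {n : ℕ} (c : V → Fin n) :
    C.parts (colorClass c) =
      (AcyclicOrientation.ofColoring C.toHypergraph c).imageComplex := by
  refine SComplex.ext_faces fun e => ⟨?_, ?_⟩
  · rintro ⟨he, i, hi⟩
    refine ⟨⟨e, he⟩, Finset.Subset.antisymm (AcyclicOrientation.subset _ _) fun x hx => ?_⟩
    have hcol : ∀ y (hy : y ∈ e), c ⟨y, C.subset_of_mem e he hy⟩ = i := fun y hy =>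
      ((mem_colorClass c i y).1 (hi hy)).2
    refine (AcyclicOrientation.mem_ofColoring c ⟨e, he⟩ ⟨x, C.subset_of_mem e he hx⟩).2
      ⟨hx, fun w hw => ?_⟩
    rw [hcol x hx]
    exact (hcol w hw).le
  · rintro ⟨e', rfl⟩
    let f := AcyclicOrientation.ofColoring C.toHypergraph c
    refine ⟨(C.isRelLowerSet_faces e'.2).2 (f.subset e') (f.nonempty e'), ?_⟩
    obtain ⟨v, hv⟩ := f.exists_mem e'
    refine ⟨c v, fun x hx => ?_⟩
    have hxV := C.subset_of_mem e'.1 e'.2 (f.subset e' hx)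
    have hv' := (AcyclicOrientation.mem_ofColoring c e' v).1 hv
    have hx' := (AcyclicOrientation.mem_ofColoring c e' ⟨x, hxV⟩).1 hx
    exact (mem_colorClass _ _ _).2 ⟨hxV, le_antisymm (hv'.2 _ hx'.1) (hx'.2 _ hv'.1)⟩

variable {K}

theorem chi_basisElem_eq_sum_colorings (ζ : Character α K) (C : SComplex V) (n : ℕ) :
    chi ζ V (basisElem K C) n =
      ∑ c : V → Fin n, ζ.val (AcyclicOrientation.ofColoring C.toHypergraph c).imageComplex := by
  unfold chi
  symm
  refine Fintype.sum_bijective _ (colorClass_bijective V n) _ _ fun c => ?_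
  rw [productCoproduct_basisElem, parts_colorClass]
  rfl

theorem chi_basisElem_eq_sum (ζ : Character α K) (C : SComplex V) (n : ℕ) :
    chi ζ V (basisElem K C) n = ∑ f : AcyclicOrientation C.toHypergraph,
      ζ.val f.imageComplex * (Nat.card {c : V → Fin n // StrictlyCompatible f c} : K) := by
  classical
  rw [chi_basisElem_eq_sum_colorings,
    ← Finset.sum_fiberwise Finset.univ (AcyclicOrientation.ofColoring C.toHypergraph (n := n))]
  refine Finset.sum_congr rfl fun f _ => ?_
  rw [Finset.sum_congr rfl (g := fun _ => ζ.val f.imageComplex)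
    fun c hc => by rw [(Finset.mem_filter.1 hc).2], Finset.sum_const, nsmul_eq_mul, mul_comm,
    Nat.card_eq_fintype_card, Fintype.card_subtype]
  congr 4
  ext c
  rw [AcyclicOrientation.strictlyCompatible_iff_eq_ofColoring]
  exact eq_comm

theorem sum_val_mul_card_of_isCharacteristic {ζ : Character α K} (hζ : ζ.IsCharacteristic)
    (C : SComplex V) {β : Type*} [Finite β] (Q : AcyclicOrientation C.toHypergraph → β → Prop) :
    ∑ f : AcyclicOrientation C.toHypergraph,
      ζ.val f.imageComplex * (Nat.card {c // Q f c} : K) =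
      (Nat.card {p : AcyclicOrientation C.toHypergraph × β //
        ζ.val p.1.imageComplex ≠ 0 ∧ Q p.1 p.2} : K) := by
  classical
  let e : {p : AcyclicOrientation C.toHypergraph × β // ζ.val p.1.imageComplex ≠ 0 ∧ Q p.1 p.2} ≃
      (f : AcyclicOrientation C.toHypergraph) × {c : β // ζ.val f.imageComplex ≠ 0 ∧ Q f c} :=
    { toFun := fun p => ⟨p.1.1, p.1.2, p.2⟩
      invFun := fun p => ⟨(p.1, p.2.1), p.2.2⟩
      left_inv := fun _ => rfl
      right_inv := fun _ => rfl }
  rw [Nat.card_congr e, Nat.card_sigma]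
  push_cast
  refine Finset.sum_congr rfl fun f _ => ?_
  rcases hζ V f.imageComplex with h | h <;> simp [h]

/-- The number of odd components of a graph has the parity of its number of vertices, and here every
component is odd. -/
theorem neg_one_pow_card_of_isOdd {ζ : Character α K} (hζ : ζ.IsOdd) {C : SComplex V}
    (h : ζ.val C ≠ 0) : (-1 : K) ^ V.card = (-1) ^ C.toHypergraph.cc := by
  classical
  have hodd : ∀ c : C.toHypergraph.toGraph.ConnectedComponent, Odd c.supp.ncard := by
    intro c
    by_contra hc
    exact h (hζ V C ⟨c, Nat.not_odd_iff_even.1 hc⟩)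
  have huniv : C.toHypergraph.toGraph.oddComponents = Set.univ :=
    Set.eq_univ_of_forall hodd
  have h1 := C.toHypergraph.toGraph.odd_ncard_oddComponents
  rw [huniv, Set.ncard_univ] at h1
  have h2 : Odd C.toHypergraph.cc ↔ Odd V.card := by
    rwa [Nat.card_eq_fintype_card (α := V), Fintype.card_coe] at h1
  rcases Nat.even_or_odd V.card with hV | hV
  · have := Nat.not_odd_iff_even.1 (fun h3 => (Nat.not_odd_iff_even.2 hV) (h2.1 h3))
    rw [hV.neg_one_pow, this.neg_one_pow]
  · rw [hV.neg_one_pow, (h2.2 hV).neg_one_pow]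

end Complexes
end HopfSC

/-! ### The proposition. -/

open HopfSC
theorem mainTheorem10 {α : Type*} [DecidableEq α] {K : Type*} [Field K] [CharZero K]
    (ζ : Character α K) (V : Finset α) (C : SComplex V) :
    -- restriction to the 1-skeleton is a bijection between the acyclic orientations of the complex
    -- and those of its 1-skeleton; `Φ` is its inverse
    ∃ Φ : AcyclicOrientation C.skeleton ≃ AcyclicOrientation C.toHypergraph,
      (∀ (f : AcyclicOrientation C.skeleton) (e : Finset α) (he : e ∈ C.skeleton.edges),
        (Φ f).toFun ⟨e, he.1⟩ = f.toFun ⟨e, he⟩) ∧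
      -- values at non-negative integers
      (∀ n : ℕ, chi ζ V (basisElem K C) n =
        ∑ f : AcyclicOrientation C.skeleton,
          ζ.val (Φ f).imageComplex *
            (Nat.card {c : V → Fin n // StrictlyCompatible f c} : K)) ∧
      (ζ.IsCharacteristic → ∀ n : ℕ, chi ζ V (basisElem K C) n =
        (Nat.card {p : AcyclicOrientation C.toHypergraph × (V → Fin n) //
          ζ.val p.1.imageComplex ≠ 0 ∧ StrictlyCompatible p.1 p.2} : K)) ∧
      -- `χ` is a polynomial in `n`, whose values at non-positive integers are as follows
      ∃ P : Polynomial K, (∀ n : ℕ, P.eval (n : K) = chi ζ V (basisElem K C) n) ∧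
        (∀ n : ℕ, P.eval (-(n : K)) =
          ∑ f : AcyclicOrientation C.skeleton,
            (-1 : K) ^ f.image.cc * ζ.val (Φ f).imageComplex *
              (Nat.card {c : V → Fin n // Compatible f c} : K)) ∧
        (ζ.IsCharacteristic → ζ.IsOdd →
          (∀ n : ℕ, (-1 : K) ^ V.card * P.eval (-(n : K)) =
            (Nat.card {p : AcyclicOrientation C.toHypergraph × (V → Fin n) //
              ζ.val p.1.imageComplex ≠ 0 ∧ Compatible p.1 p.2} : K)) ∧
          (-1 : K) ^ V.card * P.eval (-1 : K) =
            (Nat.card {f : AcyclicOrientation C.toHypergraph // ζ.val f.imageComplex ≠ 0} : K)) := by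
  let R := AcyclicOrientation.restrictEquiv C
  have hR : ∀ f, (R.symm f).restrictSkeleton = f := R.apply_symm_apply
  have hchi : ∀ n : ℕ, chi ζ V (basisElem K C) n =
      ∑ f : AcyclicOrientation C.skeleton, ζ.val (R.symm f).imageComplex *
        (Nat.card {c : V → Fin n // StrictlyCompatible f c} : K) := by
    intro n
    rw [chi_basisElem_eq_sum, ← R.symm.sum_comp]
    refine Finset.sum_congr rfl fun f _ => ?_
    simp only [← AcyclicOrientation.strictlyCompatible_restrictSkeleton, hR]
  refine ⟨R.symm, fun f e he => ?_, hchi, fun hζ n => ?_, ?_⟩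
  · conv_rhs => rw [← hR f]
    rfl
  · rw [chi_basisElem_eq_sum, sum_val_mul_card_of_isCharacteristic hζ C]
  choose P hP using fun f : AcyclicOrientation C.skeleton =>
    f.exists_coloringPolynomial K C.card_of_mem_skeleton
  let Q : Polynomial K := ∑ f, Polynomial.C (ζ.val (R.symm f).imageComplex) * P f
  have hneg : ∀ n : ℕ, Q.eval (-(n : K)) = ∑ f : AcyclicOrientation C.skeleton,
      (-1 : K) ^ f.image.cc * ζ.val (R.symm f).imageComplex *
        (Nat.card {c : V → Fin n // Compatible f c} : K) := by
    intro n
    rw [Polynomial.eval_finsetSum]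
    refine Finset.sum_congr rfl fun f _ => ?_
    rw [Polynomial.eval_mul, Polynomial.eval_C, (hP f n).2]
    ring
  refine ⟨Q, fun n => ?_, hneg, fun hζ hodd => ?_⟩
  · rw [Polynomial.eval_finsetSum, hchi]
    refine Finset.sum_congr rfl fun f _ => ?_
    rw [Polynomial.eval_mul, Polynomial.eval_C, (hP f n).1]
  have hcount : ∀ n : ℕ, (-1 : K) ^ V.card * Q.eval (-(n : K)) =
      (Nat.card {p : AcyclicOrientation C.toHypergraph × (V → Fin n) //
        ζ.val p.1.imageComplex ≠ 0 ∧ Compatible p.1 p.2} : K) := by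
    intro n
    rw [hneg, ← sum_val_mul_card_of_isCharacteristic hζ C fun f (c : V → Fin n) => Compatible f c,
      Finset.mul_sum, ← R.sum_comp]
    refine Finset.sum_congr rfl fun f _ => ?_
    rw [R.symm_apply_apply]
    -- Only terms with nonzero ζ matter; for these oddness turns (-1)^|V| into (-1)^cc, which
    -- squares away.
    by_cases h0 : ζ.val f.imageComplex = 0
    · simp [h0]
    · have hcc : (R f).image.cc = f.imageComplex.toHypergraph.cc := by
        rw [SimpleHypergraph.cc, SimpleHypergraph.cc, ← f.toGraph_image_restrictSkeleton]
        rfl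
      have hcomp : ∀ c : V → Fin n, Compatible (R f) c ↔ Compatible f c :=
        fun c => f.compatible_restrictSkeleton c
      simp only [hcomp]
      rw [neg_one_pow_card_of_isOdd hodd h0, hcc, ← mul_assoc, ← mul_assoc, ← mul_pow]
      simp
  refine ⟨hcount, ?_⟩
  -- With a single color there is one coloring, and it is compatible with every orientation.
  have h1 := hcount 1
  rw [Nat.cast_one] at h1
  rw [h1]
  congr 1
  have hall : ∀ (f : AcyclicOrientation C.toHypergraph) (c : V → Fin 1), Compatible f c :=
    fun f c e v hv => ⟨f.subset e hv, fun w _ => (Subsingleton.elim _ _).le⟩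
  refine Nat.card_congr
    { toFun := fun p => ⟨p.1.1, p.2.1⟩
      invFun := fun f => ⟨(f.1, fun _ => 0), f.2, hall _ _⟩
      left_inv := fun p => Subtype.ext (Prod.ext rfl (Subsingleton.elim _ _))
      right_inv := fun _ => rfl }
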